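/- Let $n\ge 2$, let $\mathbb{H}^n=\{x=(x_1,\dots,x_n)\in\mathbb{R}^n : x_1>0\}$ carry the hyperbolic metric $g_{\mathbb{H}^n}=x_1^{-2}\,(dx_1^2+\dots+dx_n^2)$, and let $\mathbb{H}^n\times_{-1}\mathbb{R}$ be the product $\mathbb{H}^n\times\mathbb{R}$ with the Lorentzian metric $g_{\mathbb{H}^n}-dt^2$. Put $\rho(x)=-\ln x_1$, so that the level sets of $\rho$ are the horospheres $\{x_1=\text{const}\}$ and $\operatorname{div}(\nabla\rho)=n-1$. Let $\Omega\subseteq\mathbb{H}^n$ be open and connected and let $u\in C^2(\Omega)$ be such that the graph map $\Gamma_u:\Omega\to\mathbb{H}^n\times_{-1}\mathbb{R}$, $\Gamma_u(p)=(p,u(p))$, is a time-like translator; that is, the induced metric on $\Omega$ is Lorentzian and the mean curvature vector $\mathbf{H}$ (the trace of the second fundamental form) satisfies $\mathbf{H}=(\partial_t)^{\perp}$. We say that $\Gamma_u$ is foliated by horospheres if its image is a union of sets $\{x_1=c\}\times\{t\}$ with $c>0$, $t\in\mathbb{R}$. For $x\neq\pm1$ put $$P(x)=-\tfrac14\ln|1-x|+\tfrac12\cdot\tfrac{1}{1-x}+\tfrac14\ln|1+x|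 ,$$ $P_1=P|_{(-\infty,-1)}$, $P_3=P|_{(1,\infty)}$; and, for $n>2$, $m=n-1$ and $x\ne\pm1,\,1/m$, put $$Q(x)=\tfrac{1}{2m-2}\ln|1-x|+\tfrac{1}{2m+2}\ln|1+x|-\tfrac{m}{m^2-1}\ln|1-mx| ,$$ $Q_1=Q|_{(-\infty,-1)}$, $Q_4=Q|_{(1,\infty)}$. Let $c_2=0$ and $c_n=\frac{n-1}{2n-n^2}\ln(n-1)$ for $n>2$. Then $\Gamma_u$ is foliated by horospheres if and only if there are an open interval $I\subseteq\mathbb{R}$, a number $s_0\in\mathbb{R}$ with $I\subseteq(-\infty,s_0+c_n)$, and a $C^2$ function $f:(-\infty,s_0+c_n)\to\mathbb{R}$ such that $\Omega=\rho^{-1}(I)$, $u=f\circ\rho$ on $\Omega$, and one of the following holds: 1. $n=2$, $P_1$ is a bijection onto $(-\infty,0)$, and $f'(s)=P_1^{-1}(s-s_0)$ for all $s<s_0$; 2. $n=2$, $P_3$ is a bijection onto $(-\infty,0)$, and $f'(s)=P_3^{-1}(s-s_0)$ for all $s<s_0$; 3. $n>2$, $Q_1$ is a bijection onto $(-\infty,c_n)$,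 and $f'(s)=Q_1^{-1}(s-s_0)$ for all $s<s_0+c_n$; 4. $n>2$, $Q_4$ is a bijection onto $(-\infty,c_n)$, and $f'(s)=Q_4^{-1}(s-s_0)$ for all $s<s_0+c_n$. -/

import Mathlib

open Set

noncomputable section

namespace HESU

/-! ### Immersions into a pseudo-Riemannian coordinate domain

Metrics, connections and second fundamental forms are written in global coordinates: `ι` indexes the
coordinates of the parameter domain, `κ` those of the ambient space. -/

section Immersions

variable {ι κ : Type*} [Fintype ι] [DecidableEq ι] [Fintype κ] [DecidableEq κ]

/-- The partial derivative `∂_i φ (x)`. -/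
def pd (φ : (ι → ℝ) → ℝ) (i : ι) (x : ι → ℝ) : ℝ :=
  fderiv ℝ φ x (Pi.single i 1)

/-- The Christoffel symbols `Γ^a_{bc}` of the Levi-Civita connection of the metric
`∑ g_{ab} dy^a dy^b` at the point `y`. -/
def christoffel (g : (κ → ℝ) → Matrix κ κ ℝ) (y : κ → ℝ) (a b c : κ) : ℝ :=
  (1 / 2) * ∑ d, (g y)⁻¹ a d *
    (pd (fun z => g z d c) b y + pd (fun z => g z d b) c y - pd (fun z => g z b c) d y)

/-- The coordinate tangent vector `∂_i F (x)` of a map `F`. -/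
def tangent (F : (ι → ℝ) → (κ → ℝ)) (x : ι → ℝ) (i : ι) : κ → ℝ :=
  fun a => pd (fun z => F z a) i x

/-- The pull-back `F^* g` of the ambient metric, as a matrix at the point `x`. -/
def inducedMetric (g : (κ → ℝ) → Matrix κ κ ℝ) (F : (ι → ℝ) → (κ → ℝ)) (x : ι → ℝ) :
    Matrix ι ι ℝ :=
  fun i j => ∑ a, ∑ b, g (F x) a b * tangent F x i a * tangent F x j b

/-- The orthogonal projection `X^⊥` of an ambient vector `X` at `F x` to the normal space of `F`. -/
def normalPart (g : (κ → ℝ) → Matrix κ κ ℝ) (F : (ι → ℝ) → (κ → ℝ)) (x : ι → ℝ) (X : κ → ℝ) :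
    κ → ℝ :=
  fun a => X a - ∑ i, ∑ j, (inducedMetric g F x)⁻¹ i j *
    (∑ b, ∑ c, g (F x) b c * X b * tangent F x j c) * tangent F x i a

/-- The ambient covariant derivative of `∂_j F` in the direction of `∂_i F`. -/
def covariantHessian (g : (κ → ℝ) → Matrix κ κ ℝ) (F : (ι → ℝ) → (κ → ℝ)) (x : ι → ℝ) (i j : ι) :
    κ → ℝ :=
  fun a => pd (fun z => tangent F z j a) i x +
    ∑ b, ∑ c, christoffel g (F x) a b c * tangent F x i b * tangent F x j c

/-- The mean curvature vector: the trace, with respect to the induced metric, of the second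
fundamental form `II(∂_i, ∂_j) = (∇_{∂_i F} ∂_j F)^⊥`. -/
def meanCurvatureVector (g : (κ → ℝ) → Matrix κ κ ℝ) (F : (ι → ℝ) → (κ → ℝ)) (x : ι → ℝ) : κ → ℝ :=
  fun a => ∑ i, ∑ j, (inducedMetric g F x)⁻¹ i j * normalPart g F x (covariantHessian g F x i j) a

/-- `F` restricted to `Ω` is a non-degenerate immersion with `H = v^⊥`. -/
def IsTranslator (g : (κ → ℝ) → Matrix κ κ ℝ) (v : κ → ℝ) (Ω : Set (ι → ℝ))
    (F : (ι → ℝ) → (κ → ℝ)) : Prop :=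
  ∀ x ∈ Ω, (inducedMetric g F x).det ≠ 0 ∧ meanCurvatureVector g F x = normalPart g F x v

/-- A hypersurface of a Lorentzian space is time-like if its tangent spaces are non-degenerate and
contain a time-like vector. -/
def IsTimelike (g : (κ → ℝ) → Matrix κ κ ℝ) (Ω : Set (ι → ℝ)) (F : (ι → ℝ) → (κ → ℝ)) : Prop :=
  ∀ x ∈ Ω, (inducedMetric g F x).det ≠ 0 ∧
    ∃ X : ι → ℝ, ∑ i, ∑ j, inducedMetric g F x i j * X i * X j < 0

end Immersions

/-! ### The hyperbolic Einstein static universe `ℍⁿ ×₋₁ ℝ` -/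

section Universe

variable {n : ℕ} [NeZero n]

/-- The half-space model of `ℍⁿ`; the coordinate with index `0` is the positive one. -/
def halfSpace (n : ℕ) [NeZero n] : Set (Fin n → ℝ) :=
  {x | 0 < x 0}

/-- The Lorentzian metric `x₀⁻² (dx₀² + ⋯ + dx_{n-1}²) - dt²`. -/
def metric (n : ℕ) [NeZero n] (y : Fin n ⊕ Unit → ℝ) : Matrix (Fin n ⊕ Unit) (Fin n ⊕ Unit) ℝ :=
  Matrix.diagonal (Sum.elim (fun _ => 1 / (y (Sum.inl 0)) ^ 2) (fun _ => -1))

/-- The vector field `∂_t`. -/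
def timeField (n : ℕ) : Fin n ⊕ Unit → ℝ :=
  Pi.single (Sum.inr ()) 1

/-- The graph map `p ↦ (p, u p)`. -/
def graphMap (u : (Fin n → ℝ) → ℝ) (x : Fin n → ℝ) : Fin n ⊕ Unit → ℝ :=
  Sum.elim x (fun _ => u x)

/-- The horosphere `{x₀ = c}`, for `c > 0`. -/
def horosphere (n : ℕ) [NeZero n] (c : ℝ) : Set (Fin n → ℝ) :=
  {x | x 0 = c}

/-- The graph of `u` over `Ω` is a union of horospheres lying in slices `t = const`. (Any two such
leaves are equal or disjoint.) -/
def FoliatedByHorospheres (Ω : Set (Fin n → ℝ)) (u : (Fin n → ℝ) → ℝ) : Prop :=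
  ∀ p ∈ Ω, ∃ c > 0, p ∈ horosphere n c ∧
    ∀ q ∈ horosphere n c, q ∈ Ω ∧ u q = u p

/-- The signed distance to the horosphere `{x₀ = 1}`, oriented so that `div (∇ρ) = n - 1`. -/
def rho (x : Fin n → ℝ) : ℝ :=
  -Real.log (x 0)

end Universe

/-! ### The profile functions -/

/-- A primitive of `1 / ((1 - x²) (1 - x))`. -/
def P (x : ℝ) : ℝ :=
  -(1 / 4) * Real.log |1 - x| + (1 / 2) * (1 / (1 - x)) + (1 / 4) * Real.log |1 + x|

/-- A primitive of `1 / ((1 - x²) (1 - m x))`, for `m > 1`. -/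
def Q (m x : ℝ) : ℝ :=
  1 / (2 * m - 2) * Real.log |1 - x| + 1 / (2 * m + 2) * Real.log |1 + x|
    - m / (m ^ 2 - 1) * Real.log |1 - m * x|

/-- `G` maps `D` bijectively onto `(-∞, c)`, and `f` is, on the half-line `(-∞, s₀ + c)`, a `C²`
primitive of `s ↦ (G|_D)⁻¹ (s - s₀)`. -/
def IsPrimitiveOfInverse (G : ℝ → ℝ) (D : Set ℝ) (c s₀ : ℝ) (f : ℝ → ℝ) : Prop :=
  BijOn G D (Iio c) ∧ ContDiffOn ℝ 2 f (Iio (s₀ + c)) ∧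
    ∀ s < s₀ + c, HasDerivAt f (Function.invFunOn G D (s - s₀)) s

end HESU

end

noncomputable section

namespace HESU

open Filter Topology

/-! ### The profile functions are bijections onto half-lines -/

section Profile

/-! A foliation by horospheres makes `Ω` and `u` depend on the height `x 0` alone, so `u = h ∘ ρ`.
The induced metric is then diagonal, and the time component of `H = (∂_t)^⊥` is a second-order ODE
in the height (`translator_equation`). In the variable `s = ρ`, with `y = h'` and `m = n - 1`, it
becomes autonomous: `y' = (1 - y²)(1 - m y)`, and time-likeness reads `1 < y²`
(`FoliatedByHorospheres.exists_profile`). By connectedness `y` stays in one of `(-∞, -1)`, `(1, ∞)`.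

The equation is separable. `P` (for `m = 1`) and `Q m` (for `m > 1`) are primitives `G` of `1 / ((1
- y²)(1 - m y))`, so `G (y s) = s - s₀`. On either component `G` is strictly monotone, tends to `-∞`
at `±1` and to the same finite constant at `±∞`, hence is a bijection onto a half-line. Inverting it
gives `y`, and integrating the inverse extends `h` to the whole half-line
(`exists_isPrimitiveOfInverse_eqOn`).

The converse is immediate: any function of `ρ` over `ρ⁻¹(I)` is constant on horospheres. -/

theorem bijOn_Ioi_Iio_of_hasDerivAt_pos {G G' : ℝ → ℝ} {a c : ℝ}
    (hG : ∀ x ∈ Ioi a, HasDerivAt G (G' x) x) (hpos : ∀ x ∈ Ioi a, 0 < G' x)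
    (hbot : Tendsto G (𝓝[>] a) atBot) (htop : Tendsto G atTop (𝓝 c)) :
    BijOn G (Ioi a) (Iio c) := by
  have hcont : ContinuousOn G (Ioi a) := fun x hx => (hG x hx).continuousAt.continuousWithinAt
  have hmono : StrictMonoOn G (Ioi a) := by
    refine strictMonoOn_of_deriv_pos (convex_Ioi a) hcont fun x hx => ?_
    rw [interior_Ioi] at hx
    rw [(hG x hx).deriv]
    exact hpos x hx
  refine ⟨fun x hx => ?_, hmono.injOn, ?_⟩
  -- The limit only gives `≤ c`; comparing with `x + 1` first makes the bound strict.
  · have hx' : x + 1 ∈ Ioi a := by simp only [mem_Ioi] at *; linarith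
    refine lt_of_lt_of_le (hmono hx hx' (by linarith)) ?_
    refine ge_of_tendsto htop ?_
    filter_upwards [eventually_ge_atTop (x + 1)] with z hz
    exact hmono.monotoneOn hx' (lt_of_lt_of_le hx' hz) hz
  · exact isPreconnected_Ioi.intermediate_value_Iio (l₁ := 𝓝[>] a) (l₂ := atTop)
      (le_principal_iff.2 self_mem_nhdsWithin) (le_principal_iff.2 (Ioi_mem_atTop a))
      hcont hbot htop

theorem bijOn_Iio_Iio_of_hasDerivAt_neg {G G' : ℝ → ℝ} {a c : ℝ}
    (hG : ∀ x ∈ Iio a, HasDerivAt G (G' x) x) (hneg : ∀ x ∈ Iio a, G' x < 0)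
    (hbot : Tendsto G (𝓝[<] a) atBot) (htop : Tendsto G atBot (𝓝 c)) :
    BijOn G (Iio a) (Iio c) := by
  have h : BijOn (fun x => G (-x)) (Ioi (-a)) (Iio c) := by
    refine bijOn_Ioi_Iio_of_hasDerivAt_pos (G' := fun x => -G' (-x)) (fun x hx => ?_)
      (fun x hx => ?_) ?_ (htop.comp tendsto_neg_atTop_atBot)
    · have hx' : -x ∈ Iio a := by simp only [mem_Ioi, mem_Iio] at *; linarith
      simpa using! (hG _ hx').comp x (hasDerivAt_neg x)
    · have hx' : -x ∈ Iio a := by simp only [mem_Ioi, mem_Iio] at *; linarith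
      linarith [hneg _ hx']
    · refine hbot.comp ?_
      simpa using tendsto_neg_nhdsGT (a := -a)
  have h2 : BijOn (fun x : ℝ => -x) (Iio a) (Ioi (-a)) := by
    refine ⟨fun x hx => by simpa using hx, neg_injective.injOn, fun x hx => ⟨-x, ?_, by simp⟩⟩
    simp only [mem_Ioi, mem_Iio] at *; linarith
  simpa [Function.comp_def] using h.comp h2

/-- The factor `1 * x` displays this as the case `m = 1` of the derivative of `Q m`. Strict
differentiability is what later allows differentiating the inverse. -/
theorem hasStrictDerivAt_P {x : ℝ} (h1 : 1 - x ≠ 0) (h2 : 1 + x ≠ 0) :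
    HasStrictDerivAt P ((1 - x ^ 2) * (1 - 1 * x))⁻¹ x := by
  have a1 : HasStrictDerivAt (fun x : ℝ => 1 - x) (-1) x :=
    (hasStrictDerivAt_id x).const_sub 1
  have a2 : HasStrictDerivAt (fun x : ℝ => 1 + x) 1 x := (hasStrictDerivAt_id x).const_add 1
  have h := (((a1.log h1).const_mul (-(1 / 4) : ℝ)).add
    (((hasStrictDerivAt_inv h1).comp x a1).const_mul (1 / 2 : ℝ))).add ((a2.log h2).const_mul (1 / 4 : ℝ))
  have hP : P = fun y => -(1 / 4) * Real.log (1 - y) + 1 / 2 * (1 - y)⁻¹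
      + 1 / 4 * Real.log (1 + y) := by
    ext z; simp [P, Real.log_abs]
  rw [hP]
  refine HasStrictDerivAt.congr_deriv h ?_
  rw [show 1 - x ^ 2 = (1 - x) * (1 + x) by ring, one_mul]
  field_simp
  ring

theorem hasStrictDerivAt_Q {m x : ℝ} (hm : 1 < m) (h1 : 1 - x ≠ 0) (h2 : 1 + x ≠ 0)
    (h3 : 1 - m * x ≠ 0) :
    HasStrictDerivAt (Q m) ((1 - x ^ 2) * (1 - m * x))⁻¹ x := by
  have a1 : HasStrictDerivAt (fun x : ℝ => 1 - x) (-1) x :=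
    (hasStrictDerivAt_id x).const_sub 1
  have a2 : HasStrictDerivAt (fun x : ℝ => 1 + x) 1 x := (hasStrictDerivAt_id x).const_add 1
  have a3 : HasStrictDerivAt (fun x : ℝ => 1 - m * x) (-(m * 1)) x :=
    ((hasStrictDerivAt_id x).const_mul m).const_sub 1
  have h := (((a1.log h1).const_mul (1 / (2 * m - 2))).add
    ((a2.log h2).const_mul (1 / (2 * m + 2)))).sub ((a3.log h3).const_mul (m / (m ^ 2 - 1)))
  have hQ : Q m = fun y => 1 / (2 * m - 2) * Real.log (1 - y) + 1 / (2 * m + 2) * Real.log (1 + y)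
      - m / (m ^ 2 - 1) * Real.log (1 - m * y) := by
    ext z; simp [Q, Real.log_abs]
  rw [hQ]
  refine HasStrictDerivAt.congr_deriv h ?_
  have : m - 1 ≠ 0 := by linarith
  have : m + 1 ≠ 0 := by linarith
  rw [show 1 - x ^ 2 = (1 - x) * (1 + x) by ring, show m ^ 2 - 1 = (m - 1) * (m + 1) by ring,
    show 2 * m - 2 = 2 * (m - 1) by ring, show 2 * m + 2 = 2 * (m + 1) by ring]
  field_simp
  ring

theorem profile_ne_zero {m x : ℝ} (hm : 1 ≤ m) (hx : x ∈ Iio (-1) ∪ Ioi 1) :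
    1 - x ≠ 0 ∧ 1 + x ≠ 0 ∧ 1 - m * x ≠ 0 := by
  rcases hx with hx | hx
  · simp only [mem_Iio] at hx
    refine ⟨by linarith, by linarith, ?_⟩
    have : m * x < 0 := mul_neg_of_pos_of_neg (by linarith) (by linarith)
    linarith
  · simp only [mem_Ioi] at hx
    refine ⟨by linarith, by linarith, ?_⟩
    have : 1 < m * x := by nlinarith
    linarith

theorem profile_pos {m x : ℝ} (hm : 1 ≤ m) (hx : 1 < x) : 0 < ((1 - x ^ 2) * (1 - m * x))⁻¹ :=
  inv_pos.2 (mul_pos_of_neg_of_neg (by nlinarith) (by nlinarith))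

theorem profile_neg {m x : ℝ} (hm : 1 ≤ m) (hx : x < -1) : ((1 - x ^ 2) * (1 - m * x))⁻¹ < 0 :=
  inv_lt_zero.2 (mul_neg_of_neg_of_pos (by nlinarith) (by nlinarith))

/-- A quotient of two affine functions tends to the quotient of the slopes along any filter on which
the absolute value of the variable tends to infinity. -/
theorem tendsto_log_div_affine {l : Filter ℝ} (hl : Tendsto (fun x : ℝ => x⁻¹) l (𝓝 0))
    (h0 : ∀ᶠ x in l, x ≠ 0) {p q : ℝ} (hp : p ≠ 0) (hq : q ≠ 0) :
    Tendsto (fun x => Real.log ((1 + p * x) / (1 + q * x))) l (𝓝 (Real.log (p / q))) := by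
  refine Tendsto.log ?_ (div_ne_zero hp hq)
  have h : Tendsto (fun x : ℝ => (x⁻¹ + p) / (x⁻¹ + q)) l (𝓝 ((0 + p) / (0 + q))) :=
    (hl.add_const p).div (hl.add_const q) (by simpa using hq)
  rw [zero_add, zero_add] at h
  refine h.congr' ?_
  filter_upwards [h0] with x hx
  rw [← mul_div_mul_right _ _ hx, add_mul, add_mul, inv_mul_cancel₀ hx]

theorem tendsto_P_zero {l : Filter ℝ} (hl : Tendsto (fun x : ℝ => x⁻¹) l (𝓝 0))
    (hD : ∀ᶠ x in l, x ∈ Iio (-1 : ℝ) ∪ Ioi 1) : Tendsto P l (𝓝 0) := by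
  have h0 : ∀ᶠ x in l, x ≠ 0 := by
    filter_upwards [hD] with x hx h
    rw [h] at hx; simp at hx; linarith
  -- The limit is `Real.log (1 / -1) = 0`, since `Real.log` only sees the absolute value.
  have h1 := (tendsto_log_div_affine hl h0 (p := 1) (q := -1) (by simp) (by simp)).const_mul
    (1 / 4 : ℝ)
  have h2 : Tendsto (fun x : ℝ => (1 / 2 : ℝ) * (x⁻¹ / (x⁻¹ - 1))) l (𝓝 ((1 / 2) * (0 / (0 - 1)))) :=
    (hl.div (hl.sub_const 1) (by simp)).const_mul _
  have h := h1.add h2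
  norm_num at h
  refine h.congr' ?_
  filter_upwards [hD, h0] with x hx hx0
  obtain ⟨a, b, -⟩ := profile_ne_zero le_rfl hx
  have a' : 1 + -x ≠ 0 := by rwa [← sub_eq_add_neg]
  have e : x⁻¹ / (x⁻¹ - 1) = 1 / (1 - x) := by
    rw [← mul_div_mul_right _ _ hx0, sub_mul, inv_mul_cancel₀ hx0, one_mul]
  rw [e, Real.log_div b a', P, Real.log_abs, Real.log_abs, ← sub_eq_add_neg]
  ring

/-- Since `1 / (2m - 2) + 1 / (2m + 2) = m / (m² - 1)`, the term in `log |1 - m x|` can be shared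
between the other two, leaving logarithms of quotients that converge. -/
theorem tendsto_Q {m : ℝ} (hm : 1 < m) {l : Filter ℝ} (hl : Tendsto (fun x : ℝ => x⁻¹) l (𝓝 0))
    (hD : ∀ᶠ x in l, x ∈ Iio (-1 : ℝ) ∪ Ioi 1) :
    Tendsto (Q m) l (𝓝 (-(m / (m ^ 2 - 1)) * Real.log m)) := by
  have h0 : ∀ᶠ x in l, x ≠ 0 := by
    filter_upwards [hD] with x hx h
    rw [h] at hx; simp at hx; linarith
  have hm0 : m ≠ 0 := by linarith
  have h1 := (tendsto_log_div_affine hl h0 (p := -1) (q := -m) (by simp) (by simpa)).const_mul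
    (1 / (2 * m - 2))
  have h2 := (tendsto_log_div_affine hl h0 (p := 1) (q := -m) (by simp) (by simpa)).const_mul
    (1 / (2 * m + 2))
  have h := h1.add h2
  have e2 : m ^ 2 - 1 = (m - 1) * (m + 1) := by ring
  have e3 : 2 * m - 2 = 2 * (m - 1) := by ring
  have e4 : 2 * m + 2 = 2 * (m + 1) := by ring
  have i1 : m - 1 ≠ 0 := by linarith
  have i2 : m + 1 ≠ 0 := by linarith
  have e5 : 1 / (2 * m - 2) * Real.log (-1 / -m) + 1 / (2 * m + 2) * Real.log (1 / -m) =
      -(m / (m ^ 2 - 1)) * Real.log m := by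
    rw [neg_div_neg_eq, div_neg, Real.log_neg_eq_log, one_div m, Real.log_inv, e2, e3, e4]
    field_simp
    ring
  rw [e5] at h
  refine h.congr' ?_
  filter_upwards [hD] with x hx
  obtain ⟨a, b, d⟩ := profile_ne_zero hm.le hx
  rw [show 1 + -m * x = 1 - m * x by ring, show 1 + -1 * x = 1 - x by ring, one_mul,
    Real.log_div a d, Real.log_div b d, Q, Real.log_abs, Real.log_abs, Real.log_abs, e2, e3, e4]
  field_simp
  ring

theorem tendsto_P_nhdsLT : Tendsto P (𝓝[<] (-1)) atBot := by
  have h1 : Tendsto (fun x : ℝ => 1 + x) (𝓝[<] (-1)) (𝓝[≠] 0) := by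
    refine tendsto_nhdsWithin_iff.2 ⟨?_, ?_⟩
    · exact ((continuous_const.add continuous_id).tendsto' (-1 : ℝ) 0 (by simp)).mono_left
        nhdsWithin_le_nhds
    · filter_upwards [self_mem_nhdsWithin] with x hx
      simp only [mem_Iio] at hx
      simp only [mem_compl_iff, mem_singleton_iff]
      linarith
  have h2 : Tendsto (fun x : ℝ => (1 / 4) * Real.log (1 + x)) (𝓝[<] (-1)) atBot :=
    (Real.tendsto_log_nhdsNE_zero.comp h1).const_mul_atBot (by norm_num)
  have h3 : ContinuousAt (fun x : ℝ => -(1 / 4) * Real.log (1 - x) + (1 / 2) * (1 / (1 - x)))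
      (-1) := by
    have : (1 : ℝ) - -1 ≠ 0 := by norm_num
    fun_prop (disch := assumption)
  refine ((h3.tendsto.mono_left nhdsWithin_le_nhds).add_atBot h2).congr fun x => ?_
  simp [P, Real.log_abs]

theorem tendsto_P_nhdsGT : Tendsto P (𝓝[>] 1) atBot := by
  have h1 : Tendsto (fun x : ℝ => 1 - x) (𝓝[>] 1) (𝓝[<] 0) := by
    refine tendsto_nhdsWithin_iff.2 ⟨?_, ?_⟩
    · exact ((continuous_const.sub continuous_id).tendsto' (1 : ℝ) 0 (by simp)).mono_left
        nhdsWithin_le_nhds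
    · filter_upwards [self_mem_nhdsWithin] with x hx
      simp only [mem_Ioi] at hx
      simp only [mem_Iio]
      linarith
  -- The logarithm tends to `+∞` against the pole tending to `-∞`. Factoring out `(1 - x)⁻¹` lets
  -- the pole win, because `t log t → 0`.
  have h2 : Tendsto (fun x : ℝ => -(1 / 4) * (Real.log (1 - x) * (1 - x)) + 1 / 2) (𝓝[>] 1)
      (𝓝 (-(1 / 4) * 0 + 1 / 2)) :=
    ((tendsto_log_mul_self_nhdsLT_zero.comp h1).const_mul _).add_const _
  have h3 : Tendsto (fun x : ℝ => (1 - x)⁻¹) (𝓝[>] 1) atBot :=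
    tendsto_inv_nhdsLT_zero.comp h1
  have h4 : ContinuousAt (fun x : ℝ => (1 / 4) * Real.log (1 + x)) 1 := by
    have : (1 : ℝ) + 1 ≠ 0 := by norm_num
    fun_prop (disch := assumption)
  have h5 := h3.atBot_mul_pos (by norm_num) h2
  refine ((h4.tendsto.mono_left nhdsWithin_le_nhds).add_atBot h5).congr' ?_
  filter_upwards [self_mem_nhdsWithin] with x hx
  have : 1 - x ≠ 0 := by simp only [mem_Ioi] at hx; linarith
  rw [P, Real.log_abs, Real.log_abs]
  field_simp
  ring

theorem tendsto_Q_nhdsLT {m : ℝ} (hm : 1 < m) : Tendsto (Q m) (𝓝[<] (-1)) atBot := by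
  have h1 : Tendsto (fun x : ℝ => 1 + x) (𝓝[<] (-1)) (𝓝[≠] 0) := by
    refine tendsto_nhdsWithin_iff.2 ⟨?_, ?_⟩
    · exact ((continuous_const.add continuous_id).tendsto' (-1 : ℝ) 0 (by simp)).mono_left
        nhdsWithin_le_nhds
    · filter_upwards [self_mem_nhdsWithin] with x hx
      simp only [mem_Iio] at hx
      simp only [mem_compl_iff, mem_singleton_iff]
      linarith
  have h2 : Tendsto (fun x : ℝ => (1 / (2 * m + 2)) * Real.log (1 + x)) (𝓝[<] (-1)) atBot :=
    (Real.tendsto_log_nhdsNE_zero.comp h1).const_mul_atBot (by positivity)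
  have h3 : ContinuousAt (fun x : ℝ => 1 / (2 * m - 2) * Real.log (1 - x)
      - m / (m ^ 2 - 1) * Real.log (1 - m * x)) (-1) := by
    have : (1 : ℝ) - -1 ≠ 0 := by norm_num
    have : (1 : ℝ) - m * -1 ≠ 0 := by linarith
    fun_prop (disch := assumption)
  refine ((h3.tendsto.mono_left nhdsWithin_le_nhds).add_atBot h2).congr fun x => ?_
  simp only [Q, Real.log_abs]
  ring

theorem tendsto_Q_nhdsGT {m : ℝ} (hm : 1 < m) : Tendsto (Q m) (𝓝[>] 1) atBot := by
  have h1 : Tendsto (fun x : ℝ => 1 - x) (𝓝[>] 1) (𝓝[≠] 0) := by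
    refine tendsto_nhdsWithin_iff.2 ⟨?_, ?_⟩
    · exact ((continuous_const.sub continuous_id).tendsto' (1 : ℝ) 0 (by simp)).mono_left
        nhdsWithin_le_nhds
    · filter_upwards [self_mem_nhdsWithin] with x hx
      simp only [mem_Ioi] at hx
      simp only [mem_compl_iff, mem_singleton_iff]
      linarith
  have h2 : Tendsto (fun x : ℝ => (1 / (2 * m - 2)) * Real.log (1 - x)) (𝓝[>] 1) atBot :=
    (Real.tendsto_log_nhdsNE_zero.comp h1).const_mul_atBot (one_div_pos.2 (by linarith))
  have h3 : ContinuousAt (fun x : ℝ => 1 / (2 * m + 2) * Real.log (1 + x)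
      - m / (m ^ 2 - 1) * Real.log (1 - m * x)) 1 := by
    have : (1 : ℝ) + 1 ≠ 0 := by norm_num
    have : (1 : ℝ) - m * 1 ≠ 0 := by linarith
    fun_prop (disch := assumption)
  refine ((h3.tendsto.mono_left nhdsWithin_le_nhds).add_atBot h2).congr fun x => ?_
  simp only [Q, Real.log_abs]
  ring

theorem eventually_atBot_mem_domain : ∀ᶠ x : ℝ in atBot, x ∈ Iio (-1 : ℝ) ∪ Ioi 1 := by
  filter_upwards [Iio_mem_atBot (-1 : ℝ)] with x hx using Or.inl hx

theorem eventually_atTop_mem_domain : ∀ᶠ x : ℝ in atTop, x ∈ Iio (-1 : ℝ) ∪ Ioi 1 := by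
  filter_upwards [Ioi_mem_atTop (1 : ℝ)] with x hx using Or.inr hx

theorem bijOn_P_Iio : BijOn P (Iio (-1)) (Iio 0) :=
  bijOn_Iio_Iio_of_hasDerivAt_neg
    (fun _ hx =>
      have h := profile_ne_zero le_rfl (Or.inl hx)
      (hasStrictDerivAt_P h.1 h.2.1).hasDerivAt)
    (fun _ hx => profile_neg le_rfl hx) tendsto_P_nhdsLT
    (tendsto_P_zero tendsto_inv_atBot_zero eventually_atBot_mem_domain)

theorem bijOn_P_Ioi : BijOn P (Ioi 1) (Iio 0) :=
  bijOn_Ioi_Iio_of_hasDerivAt_pos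
    (fun _ hx =>
      have h := profile_ne_zero le_rfl (Or.inr hx)
      (hasStrictDerivAt_P h.1 h.2.1).hasDerivAt)
    (fun _ hx => profile_pos le_rfl hx) tendsto_P_nhdsGT
    (tendsto_P_zero tendsto_inv_atTop_zero eventually_atTop_mem_domain)

theorem bijOn_Q_Iio {m : ℝ} (hm : 1 < m) :
    BijOn (Q m) (Iio (-1)) (Iio (-(m / (m ^ 2 - 1)) * Real.log m)) :=
  bijOn_Iio_Iio_of_hasDerivAt_neg
    (fun _ hx =>
      have h := profile_ne_zero hm.le (Or.inl hx)
      (hasStrictDerivAt_Q hm h.1 h.2.1 h.2.2).hasDerivAt)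
    (fun _ hx => profile_neg hm.le hx) (tendsto_Q_nhdsLT hm)
    (tendsto_Q hm tendsto_inv_atBot_zero eventually_atBot_mem_domain)

theorem bijOn_Q_Ioi {m : ℝ} (hm : 1 < m) :
    BijOn (Q m) (Ioi 1) (Iio (-(m / (m ^ 2 - 1)) * Real.log m)) :=
  bijOn_Ioi_Iio_of_hasDerivAt_pos
    (fun _ hx =>
      have h := profile_ne_zero hm.le (Or.inr hx)
      (hasStrictDerivAt_Q hm h.1 h.2.1 h.2.2).hasDerivAt)
    (fun _ hx => profile_pos hm.le hx) (tendsto_Q_nhdsGT hm)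
    (tendsto_Q hm tendsto_inv_atTop_zero eventually_atTop_mem_domain)

end Profile

/-! ### Separation of variables -/

section Separation

variable {G v : ℝ → ℝ} {D : Set ℝ} {c : ℝ}

/-- As `G' = 1 / v`, the inverse of `G` solves `y' = v(y)`. Openness of `D` makes `invFunOn` a left
inverse on a neighbourhood, which suffices given the strict derivative. -/
theorem hasDerivAt_invFunOn (hbij : BijOn G D (Iio c)) (hD : IsOpen D)
    (hG : ∀ x ∈ D, HasStrictDerivAt G (v x)⁻¹ x) (hv : ∀ x ∈ D, v x ≠ 0) {t : ℝ} (ht : t < c) :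
    HasDerivAt (Function.invFunOn G D) (v (Function.invFunOn G D t)) t := by
  obtain ⟨x, hx, rfl⟩ := hbij.surjOn ht
  have hleft := hbij.injOn.leftInvOn_invFunOn
  have h := (hG x hx).to_local_left_inverse (inv_ne_zero (hv x hx))
    (g := Function.invFunOn G D) (by filter_upwards [hD.mem_nhds hx] with z hz using hleft hz)
  rw [inv_inv] at h
  rw [hleft hx]
  exact h.hasDerivAt

theorem hasDerivAt_primitive_Iio {g : ℝ → ℝ} {b a s : ℝ} (hg : ContinuousOn g (Iio b))
    (ha : a < b) (hs : s < b) : HasDerivAt (fun u => ∫ t in a..u, g t) (g s) s := by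
  refine intervalIntegral.integral_hasDerivAt_right ?_ ?_ (hg.continuousAt (Iio_mem_nhds hs))
  · refine (hg.mono fun t ht => ?_).intervalIntegrable
    exact lt_of_le_of_lt ht.2 (max_lt ha hs)
  · exact hg.stronglyMeasurableAtFilter isOpen_Iio s hs

/-- Along a solution of `y' = v(y)` the function `G ∘ y` has derivative `1`, so it is a translation
and `y` is a shift of the inverse of `G`. -/
theorem exists_isPrimitiveOfInverse_eqOn (hbij : BijOn G D (Iio c)) (hD : IsOpen D)
    (hG : ∀ x ∈ D, HasStrictDerivAt G (v x)⁻¹ x) (hv : ∀ x ∈ D, v x ≠ 0)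
    (hvc : Continuous v) {I : Set ℝ} (hI : IsOpen I) (hIc : IsConnected I) {h y : ℝ → ℝ}
    (hh : ∀ s ∈ I, HasDerivAt h (y s) s) (hy : ∀ s ∈ I, HasDerivAt y (v (y s)) s)
    (hyD : ∀ s ∈ I, y s ∈ D) :
    ∃ (f : ℝ → ℝ) (s₀ : ℝ), I ⊆ Iio (s₀ + c) ∧ IsPrimitiveOfInverse G D c s₀ f ∧ EqOn h f I := by
  obtain ⟨a, ha⟩ := hIc.nonempty
  have hderiv : ∀ s ∈ I, HasDerivAt (fun s => G (y s)) 1 s := fun s hs => by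
    have := (hG _ (hyD s hs)).hasDerivAt.comp s (hy s hs)
    rwa [inv_mul_cancel₀ (hv _ (hyD s hs))] at this
  have hGy : EqOn (fun s => G (y s)) (fun s => s - (a - G (y a))) I := by
    refine hI.eqOn_of_deriv_eq hIc.isPreconnected
      (fun s hs => (hderiv s hs).differentiableAt.differentiableWithinAt)
      (by fun_prop) (fun s hs => ?_) ha (by ring)
    rw [(hderiv s hs).deriv]
    simp
  set s₀ := a - G (y a) with hs₀
  have hIs : I ⊆ Iio (s₀ + c) := fun s hs => by
    have h1 : G (y s) < c := hbij.mapsTo (hyD s hs)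
    have h2 : G (y s) = s - s₀ := hGy hs
    simp only [mem_Iio]
    linarith
  set g : ℝ → ℝ := fun s => Function.invFunOn G D (s - s₀) with hg
  have hgd : ∀ s ∈ Iio (s₀ + c), HasDerivAt g (v (g s)) s := fun s hs => by
    have hs' : s - s₀ < c := by simp only [mem_Iio] at hs; linarith
    exact (hasDerivAt_invFunOn hbij hD hG hv hs').comp_sub_const s s₀
  have hgc : ContinuousOn g (Iio (s₀ + c)) := fun s hs =>
    (hgd s hs).continuousAt.continuousWithinAt
  have hfd : ∀ s ∈ Iio (s₀ + c), HasDerivAt (fun s => h a + ∫ t in a..s, g t) (g s) s :=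
    fun s hs => (hasDerivAt_primitive_Iio hgc (hIs ha) hs).const_add _
  refine ⟨fun s => h a + ∫ t in a..s, g t, s₀, hIs, ⟨hbij, ?_, hfd⟩, ?_⟩
  -- The derivative of `g` is `v ∘ g`, which is continuous, so `g` is `C¹` and its primitive `C²`.
  · have h1 : ContDiffOn ℝ 1 g (Iio (s₀ + c)) := by
      rw [show (1 : WithTop ℕ∞) = 0 + 1 by simp, contDiffOn_succ_iff_deriv_of_isOpen isOpen_Iio]
      refine ⟨fun s hs => (hgd s hs).differentiableAt.differentiableWithinAt, by simp, ?_⟩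
      rw [contDiffOn_zero]
      exact (hvc.comp_continuousOn hgc).congr fun s hs => (hgd s hs).deriv
    rw [show (2 : WithTop ℕ∞) = 1 + 1 by norm_num, contDiffOn_succ_iff_deriv_of_isOpen isOpen_Iio]
    refine ⟨fun s hs => (hfd s hs).differentiableAt.differentiableWithinAt, by simp, ?_⟩
    exact h1.congr fun s hs => (hfd s hs).deriv
  · refine hI.eqOn_of_deriv_eq hIc.isPreconnected
      (fun s hs => (hh s hs).differentiableAt.differentiableWithinAt)
      (fun s hs => (hfd s (hIs hs)).differentiableAt.differentiableWithinAt)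
      (fun s hs => ?_) ha (by simp)
    rw [(hh s hs).deriv, (hfd s (hIs hs)).deriv, hg]
    have h2 : s - s₀ = G (y s) := (hGy hs).symm
    simp only [h2]
    exact (hbij.injOn.leftInvOn_invFunOn (hyD s hs)).symm

end Separation

/-! ### The translator equation for functions of the height coordinate -/

section Geometry

theorem pd_congr {ι : Type*} [Fintype ι] [DecidableEq ι] {φ ψ : (ι → ℝ) → ℝ} {x : ι → ℝ}
    (h : φ =ᶠ[𝓝 x] ψ) (i : ι) : pd φ i x = pd ψ i x := by
  rw [pd, pd, h.fderiv_eq]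

theorem pd_comp_apply {ι : Type*} [Fintype ι] [DecidableEq ι] {ψ : ℝ → ℝ} {ψ' : ℝ} {x : ι → ℝ}
    {k : ι} (h : HasDerivAt ψ ψ' (x k)) (i : ι) :
    pd (fun z => ψ (z k)) i x = if i = k then ψ' else 0 := by
  have h1 : HasFDerivAt (fun z : ι → ℝ => z k) (ContinuousLinearMap.proj (R := ℝ) k) x :=
    (ContinuousLinearMap.proj (R := ℝ) (φ := fun _ : ι => ℝ) k).hasFDerivAt
  have h2 := h.comp_hasFDerivAt x h1
  rw [pd, show (fun z : ι → ℝ => ψ (z k)) = ψ ∘ fun z => z k from rfl, h2.fderiv]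
  simp [Pi.single_apply, eq_comm]

theorem pd_const {ι : Type*} [Fintype ι] [DecidableEq ι] (a : ℝ) (x : ι → ℝ) (i : ι) :
    pd (fun _ => a) i x = 0 := by
  simp [pd]

theorem tangent_graphMap_inl {n : ℕ} (u : (Fin n → ℝ) → ℝ) (x : Fin n → ℝ) (i a : Fin n) :
    tangent (graphMap u) x i (Sum.inl a) = if i = a then 1 else 0 :=
  pd_comp_apply (hasDerivAt_id _) i

variable {n : ℕ} [NeZero n]

theorem inv_metric {y : Fin n ⊕ Unit → ℝ} (hy : y (Sum.inl 0) ≠ 0) :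
    (metric n y)⁻¹ = Matrix.diagonal (Sum.elim (fun _ => (y (Sum.inl 0)) ^ 2) (fun _ => -1)) := by
  refine Matrix.inv_eq_left_inv ?_
  rw [metric, Matrix.diagonal_mul_diagonal, ← Matrix.diagonal_one]
  congr 1
  ext i
  rcases i with i | i
  · simp [hy]
  · simp

theorem pd_metric {y : Fin n ⊕ Unit → ℝ} (hy : y (Sum.inl 0) ≠ 0) (a b d : Fin n ⊕ Unit) :
    pd (fun z => metric n z a b) d y =
      if d = Sum.inl 0 ∧ a = b ∧ a ≠ Sum.inr () then -2 / (y (Sum.inl 0)) ^ 3 else 0 := by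
  by_cases hab : a = b
  · subst hab
    rcases a with a | a
    · simp only [metric, Matrix.diagonal_apply_eq, Sum.elim_inl]
      have h : HasDerivAt (fun r : ℝ => 1 / r ^ 2) (-2 / (y (Sum.inl 0)) ^ 3) (y (Sum.inl 0)) := by
        have := (hasDerivAt_pow 2 (y (Sum.inl 0))).fun_inv (pow_ne_zero 2 hy)
        simp only [one_div]
        refine this.congr_deriv ?_
        field_simp
        norm_num
        ring
      rw [pd_comp_apply (k := Sum.inl 0) h]
      simp
    · simp [metric, Matrix.diagonal_apply_eq, pd_const]
  · simp [metric, pd_const, hab]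

/-- Only the time and height rows of the Christoffel symbols are needed: the time component of a
normal projection sees no other component of the vector. -/
theorem christoffel_metric_time {y : Fin n ⊕ Unit → ℝ} (hy : y (Sum.inl 0) ≠ 0)
    (b c : Fin n ⊕ Unit) : christoffel (metric n) y (Sum.inr ()) b c = 0 := by
  simp only [christoffel, pd_metric hy, inv_metric hy]
  simp

theorem christoffel_metric_height {y : Fin n ⊕ Unit → ℝ} (hy : y (Sum.inl 0) ≠ 0)
    (b c : Fin n ⊕ Unit) : christoffel (metric n) y (Sum.inl 0) b c =
      if b = c ∧ b ≠ Sum.inr () then (if b = Sum.inl 0 then -1 else 1) / y (Sum.inl 0) else 0 := by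
  simp only [christoffel, pd_metric hy, inv_metric hy]
  simp only [Matrix.diagonal_apply, Fintype.sum_sum_type]
  rcases b with b | b <;> rcases c with c | c <;> simp
  by_cases hbc : b = c
  · subst hbc
    by_cases hb : b = 0
    · subst hb
      simp
      field_simp
    · simp [hb, Ne.symm hb]
      field_simp
  · by_cases hb : b = 0
    · subst hb; simp [hbc, Ne.symm hbc]
    · simp [hbc, hb, Ne.symm hb]

variable {Ω : Set (Fin n → ℝ)} {u : (Fin n → ℝ) → ℝ} {φ φ' : ℝ → ℝ} {x : Fin n → ℝ}

theorem tangent_graphMap_inr (hΩ : IsOpen Ω) (hu : ∀ z ∈ Ω, u z = φ (z 0)) (hx : x ∈ Ω)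
    (hφ : HasDerivAt φ (φ' (x 0)) (x 0)) (i : Fin n) :
    tangent (graphMap u) x i (Sum.inr ()) = if i = 0 then φ' (x 0) else 0 := by
  rw [← pd_comp_apply hφ i]
  refine pd_congr ?_ i
  filter_upwards [hΩ.mem_nhds hx] with z hz using hu z hz

theorem inducedMetric_graphMap (hΩ : IsOpen Ω) (hu : ∀ z ∈ Ω, u z = φ (z 0)) (hx : x ∈ Ω)
    (hφ : HasDerivAt φ (φ' (x 0)) (x 0)) :
    inducedMetric (metric n) (graphMap u) x = Matrix.diagonal
      (fun i => 1 / (x 0) ^ 2 - if i = 0 then φ' (x 0) ^ 2 else 0) := by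
  ext i j
  simp only [inducedMetric, Fintype.sum_sum_type, metric, Matrix.diagonal_apply,
    tangent_graphMap_inl, Finset.univ_unique, Finset.sum_singleton, PUnit.default_eq_unit,
    tangent_graphMap_inr hΩ hu hx hφ]
  simp [graphMap]
  by_cases hij : i = j
  · subst hij
    by_cases hi : i = 0
    · simp [hi]; ring
    · simp [hi]
  · by_cases hi : i = 0
    · subst hi; simp [hij, Ne.symm hij]
    · simp [hi, hij]

theorem normalPart_graphMap_inr (hΩ : IsOpen Ω) (hu : ∀ z ∈ Ω, u z = φ (z 0)) (hx : x ∈ Ω)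
    (hφ : HasDerivAt φ (φ' (x 0)) (x 0)) {w : Fin n → ℝ}
    (hw : (inducedMetric (metric n) (graphMap u) x)⁻¹ = Matrix.diagonal w)
    (X : Fin n ⊕ Unit → ℝ) :
    normalPart (metric n) (graphMap u) x X (Sum.inr ()) = X (Sum.inr ()) -
      w 0 * (1 / (x 0) ^ 2 * X (Sum.inl 0) - φ' (x 0) * X (Sum.inr ())) * φ' (x 0) := by
  simp only [normalPart, hw, Fintype.sum_sum_type, metric, Matrix.diagonal_apply,
    tangent_graphMap_inl, Finset.univ_unique, Finset.sum_singleton, PUnit.default_eq_unit,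
    tangent_graphMap_inr hΩ hu hx hφ]
  simp [graphMap]
  exact Or.inl (Or.inl (by ring))

theorem covariantHessian_graphMap_height (hΩ : IsOpen Ω) (hu : ∀ z ∈ Ω, u z = φ (z 0))
    (hx : x ∈ Ω) (hx0 : x 0 ≠ 0) (hφ : HasDerivAt φ (φ' (x 0)) (x 0)) (i : Fin n) :
    covariantHessian (metric n) (graphMap u) x i i (Sum.inl 0) =
      (if i = 0 then -1 else 1) / x 0 := by
  have hy : graphMap u x (Sum.inl 0) ≠ 0 := hx0
  simp only [covariantHessian, christoffel_metric_height hy, Fintype.sum_sum_type,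
    tangent_graphMap_inl, Finset.univ_unique, Finset.sum_singleton, PUnit.default_eq_unit,
    tangent_graphMap_inr hΩ hu hx hφ, pd_const]
  simp [graphMap]

theorem covariantHessian_graphMap_time (hΩ : IsOpen Ω) (hu : ∀ z ∈ Ω, u z = φ (z 0))
    (hx : x ∈ Ω) (hx0 : x 0 ≠ 0) (hφ : ∀ z ∈ Ω, HasDerivAt φ (φ' (z 0)) (z 0)) {φ'' : ℝ}
    (hφ' : HasDerivAt φ' φ'' (x 0)) (i : Fin n) :
    covariantHessian (metric n) (graphMap u) x i i (Sum.inr ()) = if i = 0 then φ'' else 0 := by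
  have hy : graphMap u x (Sum.inl 0) ≠ 0 := hx0
  simp only [covariantHessian, christoffel_metric_time hy, zero_mul, Finset.sum_const_zero,
    add_zero]
  have h : (fun z => tangent (graphMap u) z i (Sum.inr ())) =ᶠ[𝓝 x]
      fun z => if i = 0 then φ' (z 0) else 0 := by
    filter_upwards [hΩ.mem_nhds hx] with z hz using tangent_graphMap_inr hΩ hu hz (hφ z hz) i
  rw [pd_congr h]
  by_cases hi : i = 0
  · simp only [hi, if_true]
    rw [pd_comp_apply hφ']
    simp
  · simp only [hi, if_false, pd_const]

/-- Otherwise every entry of the diagonal induced metric is nonnegative and no vector is time-like.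
-/
theorem one_lt_sq_of_isTimelike (hΩ : IsOpen Ω) (hu : ∀ z ∈ Ω, u z = φ (z 0)) (hx : x ∈ Ω)
    (hφ : HasDerivAt φ (φ' (x 0)) (x 0))
    (htime : IsTimelike (metric n) Ω (graphMap u)) : 1 / (x 0) ^ 2 < φ' (x 0) ^ 2 := by
  obtain ⟨-, X, hX⟩ := htime x hx
  rw [inducedMetric_graphMap hΩ hu hx hφ] at hX
  by_contra! hle
  refine absurd hX (not_lt.2 (Finset.sum_nonneg fun i _ => Finset.sum_nonneg fun j _ => ?_))
  by_cases hij : i = j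
  · subst hij
    rw [Matrix.diagonal_apply_eq, mul_assoc]
    refine mul_nonneg ?_ (mul_self_nonneg _)
    split_ifs
    · linarith
    · rw [sub_zero]; positivity
  · simp [Matrix.diagonal_apply_ne _ hij]

theorem translator_equation (hΩ : IsOpen Ω) (hu : ∀ z ∈ Ω, u z = φ (z 0))
    (hx : x ∈ Ω) (hx0 : x 0 ≠ 0) (hφ : ∀ z ∈ Ω, HasDerivAt φ (φ' (z 0)) (z 0)) {φ'' : ℝ}
    (hφ' : HasDerivAt φ' φ'' (x 0)) (hne : 1 / (x 0) ^ 2 - φ' (x 0) ^ 2 ≠ 0)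
    (htrans : IsTranslator (metric n) (timeField n) Ω (graphMap u)) :
    φ'' + φ' (x 0) / x 0 =
      (1 / (x 0) ^ 2 - φ' (x 0) ^ 2) * (1 + ((n : ℝ) - 1) * (x 0 * φ' (x 0))) := by
  have h := congrFun (htrans x hx).2 (Sum.inr ())
  set w : Fin n → ℝ := fun i =>
    if i = 0 then (1 / (x 0) ^ 2 - φ' (x 0) ^ 2)⁻¹ else (x 0) ^ 2 with hw
  have hinv : (inducedMetric (metric n) (graphMap u) x)⁻¹ = Matrix.diagonal w := by
    rw [inducedMetric_graphMap hΩ hu hx (hφ x hx)]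
    refine Matrix.inv_eq_left_inv ?_
    rw [Matrix.diagonal_mul_diagonal, ← Matrix.diagonal_one]
    congr 1
    ext i
    by_cases hi : i = 0
    · simp only [hw, hi, if_true]; exact inv_mul_cancel₀ hne
    · simp [hw, hi, hx0]
  have hw0 : w 0 = (1 / (x 0) ^ 2 - φ' (x 0) ^ 2)⁻¹ := by simp [hw]
  have hw1 : w 0 * (1 / (x 0) ^ 2 - φ' (x 0) ^ 2) = 1 := by rw [hw0, inv_mul_cancel₀ hne]
  -- The normal space is a line, so the projection of `X` depends only on its pairing with the
  -- conormal `dt - φ' dx₀`. The common factor `w 0 / x₀²` then cancels from the translator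
  -- equation.
  have key : ∀ X : Fin n ⊕ Unit → ℝ,
      normalPart (metric n) (graphMap u) x X (Sum.inr ()) =
        w 0 * (1 / (x 0) ^ 2) * (X (Sum.inr ()) - φ' (x 0) * X (Sum.inl 0)) := fun X => by
    rw [normalPart_graphMap_inr hΩ hu hx (hφ x hx) hinv]
    linear_combination (-X (Sum.inr ())) * hw1
  have hH : meanCurvatureVector (metric n) (graphMap u) x (Sum.inr ()) =
      ∑ i, w i * (w 0 * (1 / (x 0) ^ 2) *
        ((if i = 0 then φ'' else 0) - φ' (x 0) * ((if i = 0 then -1 else 1) / x 0))) := by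
    simp only [meanCurvatureVector, hinv, Matrix.diagonal_apply, ite_mul, zero_mul,
      Finset.sum_ite_eq, Finset.mem_univ, if_true]
    refine Finset.sum_congr rfl fun i _ => ?_
    rw [key, covariantHessian_graphMap_time hΩ hu hx hx0 hφ hφ',
      covariantHessian_graphMap_height hΩ hu hx hx0 (hφ x hx)]
  -- The `n - 1` directions tangent to the horosphere contribute equally; this is the source of the
  -- factor `n - 1`.
  rw [hH, key, ← Finset.add_sum_erase _ _ (Finset.mem_univ (0 : Fin n)),
    Finset.sum_congr rfl (g := fun _ => (x 0) ^ 2 * (w 0 * (1 / (x 0) ^ 2) *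
      (0 - φ' (x 0) * (1 / x 0))))] at h
  · rw [Finset.sum_const, Finset.card_erase_of_mem (Finset.mem_univ _), Finset.card_univ,
      Fintype.card_fin, nsmul_eq_mul, Nat.cast_sub (Nat.pos_of_neZero n), hw0] at h
    simp only [timeField, if_true, Pi.single_eq_same, Nat.cast_one, ne_eq, reduceCtorEq,
      not_false_eq_true, Pi.single_eq_of_ne, mul_zero, sub_zero, mul_one] at h
    generalize hK : 1 / (x 0) ^ 2 - φ' (x 0) ^ 2 = K at *
    field_simp at h ⊢
    linear_combination h
  · intro i hi
    have hi0 : i ≠ 0 := Finset.ne_of_mem_erase hi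
    simp [hw, hi0]

end Geometry

/-! ### Graphs foliated by horospheres -/

section Foliated

variable {n : ℕ} [NeZero n] {Ω : Set (Fin n → ℝ)} {u : (Fin n → ℝ) → ℝ}

theorem exp_neg_rho {x : Fin n → ℝ} (hx : x ∈ halfSpace n) : Real.exp (-rho x) = x 0 := by
  rw [rho, neg_neg, Real.exp_log hx]

theorem FoliatedByHorospheres.mem_and_eq (hfol : FoliatedByHorospheres Ω u) {p q : Fin n → ℝ}
    (hp : p ∈ Ω) (hpq : q 0 = p 0) : q ∈ Ω ∧ u q = u p := by
  obtain ⟨c, -, hpc, h⟩ := hfol p hp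
  exact h q (hpq.trans hpc)

theorem foliatedByHorospheres_of_eq_comp_rho {I : Set ℝ} {f : ℝ → ℝ}
    (hΩ : Ω = {x | x ∈ halfSpace n ∧ rho x ∈ I}) (hu : ∀ x ∈ Ω, u x = f (rho x)) :
    FoliatedByHorospheres Ω u := by
  intro p hp
  have hp' := hp
  rw [hΩ] at hp'
  refine ⟨p 0, hp'.1, rfl, fun q hq => ?_⟩
  have hq0 : q 0 = p 0 := hq
  have hrho : rho q = rho p := by rw [rho, rho, hq0]
  have hqΩ : q ∈ Ω := by
    rw [hΩ]
    refine ⟨?_, by rw [hrho]; exact hp'.2⟩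
    change 0 < q 0
    rw [hq0]
    exact hp'.1
  exact ⟨hqΩ, by rw [hu q hqΩ, hu p hp, hrho]⟩

/-- A time-like translating graph foliated by horospheres is `u = h ∘ ρ` over `ρ⁻¹(I)`, where `h'`
solves the autonomous equation `y' = (1 - y²) (1 - (n - 1) y)` and satisfies `1 < y²`. -/
theorem FoliatedByHorospheres.exists_profile (hfol : FoliatedByHorospheres Ω u)
    (hΩH : Ω ⊆ halfSpace n) (hΩo : IsOpen Ω) (hΩc : IsConnected Ω) (hu : ContDiffOn ℝ 2 u Ω)
    (htime : IsTimelike (metric n) Ω (graphMap u))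
    (htrans : IsTranslator (metric n) (timeField n) Ω (graphMap u)) :
    ∃ (I : Set ℝ) (h y : ℝ → ℝ), IsOpen I ∧ IsConnected I ∧
      Ω = {x | x ∈ halfSpace n ∧ rho x ∈ I} ∧ (∀ x ∈ Ω, u x = h (rho x)) ∧
      (∀ s ∈ I, HasDerivAt h (y s) s) ∧
      (∀ s ∈ I, HasDerivAt y ((1 - y s ^ 2) * (1 - ((n : ℝ) - 1) * y s)) s) ∧
      ∀ s ∈ I, 1 < y s ^ 2 := by
  have hsingle : ContDiff ℝ 2 (fun r : ℝ => (Pi.single 0 r : Fin n → ℝ)) :=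
    (ContinuousLinearMap.single ℝ (fun _ : Fin n => ℝ) 0).contDiff
  -- Each horosphere meets the axis `r ↦ (r, 0, …, 0)` exactly once, so the trace of `Ω` and of `u`
  -- on this axis determines both.
  set J : Set ℝ := {r | (Pi.single 0 r : Fin n → ℝ) ∈ Ω} with hJ
  have hJo : IsOpen J := hΩo.preimage hsingle.continuous
  set φ : ℝ → ℝ := fun r => u (Pi.single 0 r) with hφdef
  have hφ2 : ContDiffOn ℝ 2 φ J := hu.comp hsingle.contDiffOn fun r hr => hr
  have hφ1 : ContDiffOn ℝ 1 (deriv φ) J := by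
    rw [show (2 : WithTop ℕ∞) = 1 + 1 by norm_num, contDiffOn_succ_iff_deriv_of_isOpen hJo] at hφ2
    exact hφ2.2.2
  have hd1 : ∀ r ∈ J, HasDerivAt φ (deriv φ r) r := fun r hr =>
    ((hφ2.differentiableOn (by norm_num)).differentiableAt (hJo.mem_nhds hr)).hasDerivAt
  have hd2 : ∀ r ∈ J, HasDerivAt (deriv φ) (deriv (deriv φ) r) r := fun r hr =>
    ((hφ1.differentiableOn (by norm_num)).differentiableAt (hJo.mem_nhds hr)).hasDerivAt
  have hmem : ∀ x ∈ Ω, x 0 ∈ J := fun x hx => (hfol.mem_and_eq hx (by simp)).1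
  have huφ : ∀ x ∈ Ω, u x = φ (x 0) := fun x hx => ((hfol.mem_and_eq hx (by simp)).2).symm
  have hexp : ∀ s : ℝ, HasDerivAt (fun s => Real.exp (-s)) (-Real.exp (-s)) s := fun s => by
    simpa using (hasDerivAt_neg s).exp
  have hΩeq : Ω = {x | x ∈ halfSpace n ∧ rho x ∈ (fun s => Real.exp (-s)) ⁻¹' J} := by
    ext x
    refine ⟨fun hx => ⟨hΩH hx, ?_⟩, fun ⟨hx, hx'⟩ => ?_⟩
    · rw [mem_preimage, exp_neg_rho (hΩH hx)]
      exact hmem x hx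
    · rw [mem_preimage, exp_neg_rho hx] at hx'
      exact (hfol.mem_and_eq (p := Pi.single 0 (x 0)) hx' (by simp)).1
  have himage : rho '' Ω = (fun s => Real.exp (-s)) ⁻¹' J := by
    ext s
    refine ⟨?_, fun hs => ⟨Pi.single 0 (Real.exp (-s)), hs, by simp [rho]⟩⟩
    rintro ⟨x, hx, rfl⟩
    rw [hΩeq] at hx
    exact hx.2
  have hconn : IsConnected ((fun s => Real.exp (-s)) ⁻¹' J) := by
    rw [← himage]
    refine hΩc.image _ fun x hx => ?_
    have hx0 : x 0 ≠ 0 := (hΩH hx).ne'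
    have hc : ContinuousAt (fun z : Fin n → ℝ => z 0) x := (continuous_apply 0).continuousAt
    exact (hc.log hx0).neg.continuousWithinAt
  have hode : ∀ r ∈ J, 0 < r ∧ 1 / r ^ 2 < deriv φ r ^ 2 ∧ deriv (deriv φ) r + deriv φ r / r =
      (1 / r ^ 2 - deriv φ r ^ 2) * (1 + ((n : ℝ) - 1) * (r * deriv φ r)) := fun r hr => by
    have hr' : (Pi.single 0 r : Fin n → ℝ) ∈ Ω := hr
    have e : (Pi.single 0 r : Fin n → ℝ) 0 = r := by simp
    have hr0 : 0 < (Pi.single 0 r : Fin n → ℝ) 0 := hΩH hr'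
    have h1 := one_lt_sq_of_isTimelike hΩo huφ hr' (φ' := deriv φ) (by rw [e]; exact hd1 r hr) htime
    have h2 := translator_equation hΩo huφ hr' hr0.ne' (φ' := deriv φ)
      (fun z hz => hd1 _ (hmem z hz)) (by rw [e]; exact hd2 r hr) (by linarith) htrans
    rw [e] at hr0 h1 h2
    exact ⟨hr0, h1, h2⟩
  -- With `r = exp (-s)`, the chain rule gives `y = -r φ'(r)` and `y' = r² (φ'' + φ' / r)`, so
  -- multiplying the height equation by `r²` removes all explicit dependence on `r`.
  refine ⟨(fun s => Real.exp (-s)) ⁻¹' J, fun s => φ (Real.exp (-s)),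
    fun s => deriv φ (Real.exp (-s)) * -Real.exp (-s), hJo.preimage (by fun_prop), hconn, hΩeq,
    fun x hx => ?_, fun s hs => ?_, fun s hs => ?_, fun s hs => ?_⟩
  · simp only [exp_neg_rho (hΩH hx)]
    exact huφ x hx
  · exact (hd1 _ hs).comp s (hexp s)
  · obtain ⟨hr, -, h⟩ := hode _ hs
    refine (((hd2 _ hs).comp s (hexp s)).mul (hexp s).neg).congr_deriv ?_
    simp only [Function.comp_apply, Pi.neg_apply] at hr h ⊢
    generalize Real.exp (-s) = r at hr h ⊢
    field_simp at h
    linear_combination h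
  · obtain ⟨hr, h, -⟩ := hode _ hs
    rw [div_lt_iff₀ (by positivity)] at h
    rw [mul_pow, neg_sq]
    exact h

theorem subset_Iio_or_subset_Ioi {I : Set ℝ} (hI : IsPreconnected I) {y : ℝ → ℝ}
    (hy : ContinuousOn y I) (h : ∀ s ∈ I, 1 < y s ^ 2) :
    (∀ s ∈ I, y s ∈ Iio (-1 : ℝ)) ∨ ∀ s ∈ I, y s ∈ Ioi (1 : ℝ) := by
  have hdisj : Disjoint (Iio (-1 : ℝ)) (Ioi 1) := by
    rw [Set.disjoint_left]
    intro x hx hx'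
    simp only [mem_Iio, mem_Ioi] at hx hx'
    linarith
  have hsub : y '' I ⊆ Iio (-1) ∪ Ioi 1 := by
    rintro _ ⟨s, hs, rfl⟩
    have h1 := h s hs
    rw [one_lt_sq_iff_one_lt_abs, lt_abs] at h1
    rcases h1 with h1 | h1
    · exact Or.inr h1
    · exact Or.inl (by simp only [mem_Iio]; linarith)
  rcases (hI.image y hy).subset_or_subset isOpen_Iio isOpen_Ioi hdisj hsub with h1 | h1
  · exact Or.inl fun s hs => h1 ⟨s, hs, rfl⟩
  · exact Or.inr fun s hs => h1 ⟨s, hs, rfl⟩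

end Foliated

end HESU

end

theorem theorem3p2 (n : ℕ) [NeZero n] (hn : 2 ≤ n)
    (Ω : Set (Fin n → ℝ)) (hΩH : Ω ⊆ HESU.halfSpace n) (hΩo : IsOpen Ω) (hΩc : IsConnected Ω)
    (u : (Fin n → ℝ) → ℝ) (hu : ContDiffOn ℝ 2 u Ω)
    (htime : HESU.IsTimelike (HESU.metric n) Ω (HESU.graphMap u))
    (htrans : HESU.IsTranslator (HESU.metric n) (HESU.timeField n) Ω (HESU.graphMap u)) :
    HESU.FoliatedByHorospheres Ω u ↔
      ∃ (I : Set ℝ) (f : ℝ → ℝ) (s₀ c : ℝ),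
        IsOpen I ∧ I.OrdConnected ∧ I ⊆ Set.Iio (s₀ + c) ∧
        Ω = {x | x ∈ HESU.halfSpace n ∧ HESU.rho x ∈ I} ∧
        (∀ x ∈ Ω, u x = f (HESU.rho x)) ∧
        ((n = 2 ∧ c = 0 ∧
            (HESU.IsPrimitiveOfInverse HESU.P (Set.Iio (-1)) c s₀ f ∨
              HESU.IsPrimitiveOfInverse HESU.P (Set.Ioi 1) c s₀ f)) ∨
          (2 < n ∧ c = ((n : ℝ) - 1) / (2 * n - (n : ℝ) ^ 2) * Real.log ((n : ℝ) - 1) ∧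
            (HESU.IsPrimitiveOfInverse (HESU.Q ((n : ℝ) - 1)) (Set.Iio (-1)) c s₀ f ∨
              HESU.IsPrimitiveOfInverse (HESU.Q ((n : ℝ) - 1)) (Set.Ioi 1) c s₀ f))) := by
  refine ⟨fun hfol => ?_, fun ⟨I, f, s₀, c, _, _, _, hΩ, huf, _⟩ =>
    HESU.foliatedByHorospheres_of_eq_comp_rho hΩ huf⟩
  obtain ⟨I, h, y, hIo, hIc, hΩ, huh, hh, hy, hy1⟩ :=
    hfol.exists_profile hΩH hΩo hΩc hu htime htrans
  have hyc : ContinuousOn y I := fun s hs => (hy s hs).continuousAt.continuousWithinAt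
  have hm : (1 : ℝ) ≤ (n : ℝ) - 1 := by
    have : (2 : ℝ) ≤ n := by exact_mod_cast hn
    linarith
  have hsub : ∀ D ∈ ({Set.Iio (-1), Set.Ioi 1} : Set (Set ℝ)), D ⊆ Set.Iio (-1) ∪ Set.Ioi 1 := by
    rintro D (rfl | rfl)
    exacts [Set.subset_union_left, Set.subset_union_right]
  have hopen : ∀ D ∈ ({Set.Iio (-1), Set.Ioi 1} : Set (Set ℝ)), IsOpen D := by
    rintro D (rfl | rfl)
    exacts [isOpen_Iio, isOpen_Ioi]
  have hcase : ∃ D ∈ ({Set.Iio (-1), Set.Ioi 1} : Set (Set ℝ)), ∀ s ∈ I, y s ∈ D := by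
    rcases HESU.subset_Iio_or_subset_Ioi hIc.isPreconnected hyc hy1 with h1 | h1
    exacts [⟨_, by simp, h1⟩, ⟨_, by simp, h1⟩]
  obtain ⟨D, hD, hyD⟩ := hcase
  -- The equilibria `±1` and `1 / (n - 1)` all lie in `[-1, 1]`, outside `D`.
  have hv : ∀ x ∈ D, (1 - x ^ 2) * (1 - ((n : ℝ) - 1) * x) ≠ 0 := fun x hx => by
    obtain ⟨h1, h2, h3⟩ := HESU.profile_ne_zero hm (hsub D hD hx)
    rw [show 1 - x ^ 2 = (1 - x) * (1 + x) by ring]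
    exact mul_ne_zero (mul_ne_zero h1 h2) h3
  rcases hn.eq_or_lt with h2 | h2
  · subst h2
    -- For `n = 2` the roots `1` and `1 / (n - 1)` coincide; the double root is why `P` has a
    -- rational term and replaces `Q`.
    have hcast : ((2 : ℕ) : ℝ) - 1 = 1 := by norm_num
    rw [hcast] at hv
    simp only [hcast] at hy
    have hbij : Set.BijOn HESU.P D (Set.Iio 0) := by
      rcases hD with rfl | rfl
      exacts [HESU.bijOn_P_Iio, HESU.bijOn_P_Ioi]
    obtain ⟨f, s₀, hIs, hprim, hhf⟩ := HESU.exists_isPrimitiveOfInverse_eqOn hbij (hopen D hD)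
      (fun x hx =>
        have h0 := HESU.profile_ne_zero le_rfl (hsub D hD hx)
        HESU.hasStrictDerivAt_P h0.1 h0.2.1)
      hv (by fun_prop) hIo hIc hh hy hyD
    refine ⟨I, f, s₀, 0, hIo, hIc.isPreconnected.ordConnected, hIs, hΩ, fun x hx => ?_,
      Or.inl ⟨rfl, rfl, ?_⟩⟩
    · rw [huh x hx]
      rw [hΩ] at hx
      exact hhf hx.2
    · rcases hD with rfl | rfl
      exacts [Or.inl hprim, Or.inr hprim]
  · have hm' : (1 : ℝ) < (n : ℝ) - 1 := by
      have : (3 : ℝ) ≤ n := by exact_mod_cast h2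
      linarith
    have hc : -(((n : ℝ) - 1) / (((n : ℝ) - 1) ^ 2 - 1)) * Real.log ((n : ℝ) - 1) =
        ((n : ℝ) - 1) / (2 * n - (n : ℝ) ^ 2) * Real.log ((n : ℝ) - 1) := by
      rw [← div_neg]
      congr 2
      ring
    have hbij : Set.BijOn (HESU.Q ((n : ℝ) - 1)) D
        (Set.Iio (((n : ℝ) - 1) / (2 * n - (n : ℝ) ^ 2) * Real.log ((n : ℝ) - 1))) := by
      rw [← hc]
      rcases hD with rfl | rfl
      exacts [HESU.bijOn_Q_Iio hm', HESU.bijOn_Q_Ioi hm']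
    obtain ⟨f, s₀, hIs, hprim, hhf⟩ := HESU.exists_isPrimitiveOfInverse_eqOn hbij (hopen D hD)
      (fun x hx =>
        have h0 := HESU.profile_ne_zero hm (hsub D hD hx)
        HESU.hasStrictDerivAt_Q hm' h0.1 h0.2.1 h0.2.2)
      hv (by fun_prop) hIo hIc hh hy hyD
    refine ⟨I, f, s₀, _, hIo, hIc.isPreconnected.ordConnected, hIs, hΩ, fun x hx => ?_,
      Or.inr ⟨h2, rfl, ?_⟩⟩
    · rw [huh x hx]
      rw [hΩ] at hx
      exact hhf hx.2
    · rcases hD with rfl | rfl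
      exacts [Or.inl hprim, Or.inr hprim]
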